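/- **Setting.** Let $X\in\mathbb R^{n\times p}$ be deterministic, $\beta^*\in\mathbb R^p$, $\sigma>0$, and $y=X\beta^*+\varepsilon$ with $\varepsilon\sim N(0,\sigma^2 I_n)$. Write $\|\cdot\|$ for the Euclidean norm, $|\beta|_0$ for the number of nonzero components of $\beta$, and let $s=|\beta^*|_0\ge 1$. Let $\hat\beta$ be any Lasso solution, $$\hat\beta\in\operatorname{argmin}_{\beta\in\mathbb R^p}\ \|X\beta-y\|^2+2\sqrt n\,\lambda\|\beta\|_1 .$$ Let $\delta_s$ be the smallest $\delta\ge 0$ such that $(1-\delta)\|\beta\|\le \frac1{\sqrt n}\|X\beta\|\le(1+\delta)\|\beta\|$ for all $\beta$ with $|\beta|_0\le s$. For $c_0>0$ let $$\kappa(c_0,s)=\inf\Big\{\frac{\|X\alpha\|}{\sqrt n\,\|\alpha\|}:\ \alpha\in\mathbb R^p\setminus\{0\},\ \sum_{j=s+1}^p\alpha^*_j\le c_0\sqrt s\,\|\alpha\|\Big\},$$ where $\alpha_1^*\ge\dots\ge\alpha_p^*$ are the numbers $|\alpha_1|,\dots,|\alpha_p|$ in decreasing order. Fix $\gamma>0$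 and put $$c_0=\frac{1+\gamma+\sqrt3}{\gamma},\qquad \underline C=\frac{1}{1+\delta_s},\qquad \bar C=\frac{1}{\kappa(c_0,s)}\left(1+\frac{\sigma\,\kappa(c_0,s)\,(\sqrt s+2\sqrt{\log 3})}{\lambda\sqrt s}+\frac{\sqrt3}{\sqrt{\log(9ep/s)}}\right).$$ **Theorem.** (i) Assume the restricted eigenvalue condition $\kappa(c_0,s)>0$ and $$\lambda\ \ge\ \sigma(1+\gamma)(1+\delta_s)\bigl(1+\sqrt{2\log(9ep/s)}\bigr).$$ Then with probability at least $0.76$, $$\|X(\hat\beta-\beta^*)\|\le \bar C\,\lambda\sqrt s .$$ If furthermore $\bar C\le 2\underline C$ and $$\min_{j:\beta^*_j\ne0}|\beta^*_j|\ \ge\ \frac{(2\underline C-\bar C)\,\underline C\,\lambda}{\sqrt n},\tag{1}$$ then with probability at least $0.26$, $$\|X(\hat\beta-\beta^*)\|\ \ge\ \lambda\sqrt s\;\underline C\Bigl(1-\sqrt{\bar C/\underline C-1}\Bigr).$$ (ii) (Asymptotic tightness.) Let $\sigma,\gamma>0$ be fixed and consider a sequence of such problems ($n,p,X,\beta^*,s$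 depend on an index $k\to\infty$, with $s\ge1$) such that $p/s\to\infty$, $\delta_s\to0$, $\kappa(c_0,s)\to1$, with $\lambda=\sigma(1+2\gamma)\sqrt{2\log(p/s)}$. Then $\bar C\to1$, $\underline C\to 1$ and $\underline C(1-\sqrt{\bar C/\underline C-1})\to1$, and for every sufficiently large $k$ for which (1) holds, $$\mathbb P\left(\underline C\Bigl(1-\sqrt{\bar C/\underline C-1}\Bigr)\ \le\ \frac{\|X(\hat\beta-\beta^*)\|}{\lambda\sqrt s}\ \le\ \bar C\right)\ \ge\ 0.25 .$$ -/

import Mathlib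

open MeasureTheory ProbabilityTheory Filter Topology

namespace ExactLasso

noncomputable section

/-- The sparsity of `β`: the number of its nonzero components. -/
def sparsity {p : ℕ} (β : EuclideanSpace ℝ (Fin p)) : ℕ :=
  (Finset.univ.filter fun j => β j ≠ 0).card

/-- The `ℓ¹` norm of `β`. -/
def l1Norm {p : ℕ} (β : EuclideanSpace ℝ (Fin p)) : ℝ :=
  ∑ j, |β j|

/-- The components of `α` in absolute value, arranged in decreasing order. -/
def absRearr {p : ℕ} (α : EuclideanSpace ℝ (Fin p)) : Fin p → ℝ :=
  fun j => |α (Tuple.sort (fun i => -|α i|) j)|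

theorem absRearr_antitone {p : ℕ} (α : EuclideanSpace ℝ (Fin p)) : Antitone (absRearr α) := by
  intro i j hij
  have h := Tuple.monotone_sort (fun i => -|α i|) hij
  simpa [absRearr] using h

/-- The sum of all but the `s` largest components of `α` in absolute value
(the indices in `Fin p` start at `0`). -/
def tailSum {p : ℕ} (s : ℕ) (α : EuclideanSpace ℝ (Fin p)) : ℝ :=
  ∑ j ∈ Finset.univ.filter (fun j : Fin p => s ≤ j.val), absRearr α j

/-- The restricted isometry constant `δ_s`. -/
def ripConst {n p : ℕ} (X : Matrix (Fin n) (Fin p) ℝ) (s : ℕ) : ℝ :=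
  sInf {δ : ℝ | 0 ≤ δ ∧ ∀ β : EuclideanSpace ℝ (Fin p), sparsity β ≤ s →
    (1 - δ) * ‖β‖ ≤ 1 / √(n : ℝ) * ‖X.toEuclideanLin β‖ ∧
    1 / √(n : ℝ) * ‖X.toEuclideanLin β‖ ≤ (1 + δ) * ‖β‖}

/-- The restricted eigenvalue constant `κ(c₀, s)`. -/
def reConst {n p : ℕ} (X : Matrix (Fin n) (Fin p) ℝ) (c₀ : ℝ) (s : ℕ) : ℝ :=
  sInf {r : ℝ | ∃ α : EuclideanSpace ℝ (Fin p), α ≠ 0 ∧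
    tailSum s α ≤ c₀ * √(s : ℝ) * ‖α‖ ∧
    r = ‖X.toEuclideanLin α‖ / (√(n : ℝ) * ‖α‖)}

/-- The cone parameter `c₀ = (1 + γ + √3) / γ`. -/
def coneConst (γ : ℝ) : ℝ := (1 + γ + √3) / γ

/-- `L(s, p) = log (9 e p / s)`. -/
def logTerm (p s : ℕ) : ℝ := Real.log (9 * Real.exp 1 * p / s)

/-- The lower constant `1 / (1 + δ_s)`. -/
def lowerC {n p : ℕ} (X : Matrix (Fin n) (Fin p) ℝ) (s : ℕ) : ℝ :=
  1 / (1 + ripConst X s)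

/-- The upper constant
`(1 / κ) * (1 + σ κ (√s + 2 √(log 3)) / (λ √s) + √3 / √(log (9 e p / s)))` with
`κ = κ(c₀, s)`. -/
def upperC {n p : ℕ} (X : Matrix (Fin n) (Fin p) ℝ) (s : ℕ) (σ γ lam : ℝ) : ℝ :=
  1 / reConst X (coneConst γ) s *
    (1 + σ * reConst X (coneConst γ) s * (√(s : ℝ) + 2 * √(Real.log 3)) / (lam * √(s : ℝ))
      + √3 / √(logTerm p s))

/-- The Lasso penalty `h(β) = √n λ ‖β‖₁`. -/
def lassoPenalty (n : ℕ) {p : ℕ} (lam : ℝ) (β : EuclideanSpace ℝ (Fin p)) : ℝ :=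
  √(n : ℝ) * lam * l1Norm β

/-- `b` minimizes `β ↦ ‖X β - y‖² + 2 h(β)` over `ℝᵖ`, `h` being the Lasso penalty. -/
def IsLasso {n p : ℕ} (X : Matrix (Fin n) (Fin p) ℝ) (lam : ℝ)
    (y : EuclideanSpace ℝ (Fin n)) (b : EuclideanSpace ℝ (Fin p)) : Prop :=
  ∀ β : EuclideanSpace ℝ (Fin p),
    ‖X.toEuclideanLin b - y‖ ^ 2 + 2 * lassoPenalty n lam b ≤
      ‖X.toEuclideanLin β - y‖ ^ 2 + 2 * lassoPenalty n lam β

/-- The distribution `N(0, σ² I)` on `ℝⁿ`. -/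
def gaussianNoise (n : ℕ) (σ : ℝ) : Measure (EuclideanSpace ℝ (Fin n)) :=
  multivariateGaussian 0 (σ ^ 2 • (1 : Matrix (Fin n) (Fin n) ℝ))

/-- The prediction error `‖X (b - β*)‖`. -/
def predError {n p : ℕ} (X : Matrix (Fin n) (Fin p) ℝ)
    (b βstar : EuclideanSpace ℝ (Fin p)) : ℝ :=
  ‖X.toEuclideanLin (b - βstar)‖

/-- The beta-min condition
`min_{j : β*_j ≠ 0} |β*_j| ≥ (2 C_low - C_up) C_low λ / √n`. -/
def BetaMin {n p : ℕ} (X : Matrix (Fin n) (Fin p) ℝ) (βstar : EuclideanSpace ℝ (Fin p))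
    (σ γ lam : ℝ) : Prop :=
  ∀ j, βstar j ≠ 0 →
    (2 * lowerC X (sparsity βstar) - upperC X (sparsity βstar) σ γ lam) *
      lowerC X (sparsity βstar) * lam / √(n : ℝ) ≤ |βstar j|

/-- The factor `C_low (1 - √(C_up / C_low - 1))` of the lower bound. -/
def lowerFactor {n p : ℕ} (X : Matrix (Fin n) (Fin p) ℝ) (s : ℕ) (σ γ lam : ℝ) : ℝ :=
  lowerC X s * (1 - √(upperC X s σ γ lam / lowerC X s - 1))

end

end ExactLasso

open ExactLasso

/-! All randomness is confined to one event (`goodNoise`) on the noise `e`. Let `S` be the support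
of `β*`, `K` the span of the columns of `X` in `S`, `w = σ(1 + δ_s)`, `L = log(9ep/s)`, `τ =
w√(2L)`. The event asks that the projection of `e` on `K` have norm at most `σ(√s + 2√(log 3))`, and
that the correlations of `e` with the normalized columns, projected off `K`, exceed `τ` by a total
of at most `6w²s` in squared sum. A chi-square bound and Markov's inequality give it probability at
least `1 - 1/9 - 1/27`.

On this event a deterministic bound holds for every direction `u` (`inner_add_penalty_le`), with `h`
the penalty: `⟪e, Xu⟫ + h(β*) - h(β* + u) ≤ C̄ λ √s ‖Xu‖`. The projected part of the noise gives the
`σ`-term of `C̄`. For the rest, either the `ℓ¹` mass of `u` off `S` makes the remainder nonpositive,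
or `u` lies in the cone defining `κ` and `√n ‖u‖ ≤ ‖Xu‖ / κ`.

Both error bounds follow from the first order condition `IsLasso.inner_le`. Testing it against `β*`
gives the upper bound. Testing it against `β*` shrunk by `t` along its sign vector `g` gives, when
`⟪e, Xg⟫ ≤ 0` (probability at least `1/2`), a quadratic inequality in `‖X(β̂ - β*)‖` whose smaller
root is the lower bound; beta-min ensures that the shrinkage crosses no zero. For the asymptotic
part, the tuning condition eventually holds and the constants tend to `1`. -/

namespace ExactLasso

open scoped RealInnerProductSpace

/-! ### Gaussian estimates -/

section StdGaussian

variable {E : Type*} [NormedAddCommGroup E] [InnerProductSpace ℝ E] [FiniteDimensional ℝ E]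
  [MeasurableSpace E] [BorelSpace E]

/-- The characteristic function at a functional depends only on its norm, and composing with the
projection preserves that norm. This reduces the projected noise to a chi-square in dimension `dim
K`. -/
theorem stdGaussian_map_orthogonalProjectionOnto (K : Submodule ℝ E) :
    (stdGaussian E).map K.orthogonalProjectionOnto = stdGaussian K := by
  apply Measure.ext_of_charFunDual
  ext L
  rw [charFunDual_map, charFunDual_stdGaussian, charFunDual_stdGaussian]
  have h : ‖L ∘SL K.orthogonalProjectionOnto‖ = ‖L‖ := by
    apply le_antisymm
    · refine (ContinuousLinearMap.opNorm_comp_le _ _).trans ?_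
      exact mul_le_of_le_one_right (norm_nonneg _) K.orthogonalProjectionOnto_norm_le
    · refine L.opNorm_le_bound (norm_nonneg _) fun x => ?_
      simpa using (L ∘SL K.orthogonalProjectionOnto).le_opNorm (x : E)
  rw [h]

theorem integral_exp_mul_sq_gaussianReal {t : ℝ} (ht : t < 1 / 2) :
    ∫ x, Real.exp (t * x ^ 2) ∂gaussianReal 0 1 = (√(1 - 2 * t))⁻¹ := by
  rw [integral_gaussianReal_eq_integral_smul one_ne_zero]
  have h : ∀ x : ℝ, gaussianPDFReal 0 1 x • Real.exp (t * x ^ 2) =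
      (√(2 * Real.pi))⁻¹ * Real.exp (-(1 / 2 - t) * x ^ 2) := by
    intro x
    rw [gaussianPDFReal, smul_eq_mul, mul_assoc, ← Real.exp_add]
    simp only [NNReal.coe_one, mul_one]
    congr 2
    ring
  simp_rw [h]
  rw [integral_const_mul, integral_gaussian, ← Real.sqrt_inv, ← Real.sqrt_inv,
    ← Real.sqrt_mul (by positivity)]
  congr 1
  have := Real.pi_pos
  have h1 : 1 - 2 * t ≠ 0 := by linarith
  have h2 : 1 / 2 - t ≠ 0 := by linarith
  field_simp

theorem integral_exp_mul_norm_sq_stdGaussian {t : ℝ} (ht : t < 1 / 2) :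
    ∫ x, Real.exp (t * ‖x‖ ^ 2) ∂stdGaussian E =
      (√(1 - 2 * t))⁻¹ ^ Module.finrank ℝ E := by
  rw [stdGaussian, integral_map (Measurable.aemeasurable (by fun_prop))
    (Measurable.aestronglyMeasurable (by fun_prop))]
  have h : ∀ x : Fin (Module.finrank ℝ E) → ℝ,
      Real.exp (t * ‖∑ i, x i • stdOrthonormalBasis ℝ E i‖ ^ 2) =
        ∏ i, Real.exp (t * x i ^ 2) := by
    intro x
    rw [← Real.exp_sum, ← Finset.mul_sum, ← real_inner_self_eq_norm_sq,
      (stdOrthonormalBasis ℝ E).orthonormal.inner_sum]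
    simp [pow_two]
  simp_rw [h]
  rw [integral_fintype_prod_eq_pow (fun x : ℝ => Real.exp (t * x ^ 2)),
    integral_exp_mul_sq_gaussianReal ht, Fintype.card_fin]

/-- The chi-square deviation bound: a standard Gaussian vector in dimension at most `s` has norm at
least `√s + a` with probability at most `exp (- a² / 2)`. -/
theorem stdGaussian_norm_ge_le {s : ℕ} (hs : 1 ≤ s) (hd : Module.finrank ℝ E ≤ s) {a : ℝ}
    (ha : 0 < a) :
    (stdGaussian E).real {x | √(s : ℝ) + a ≤ ‖x‖} ≤ Real.exp (-a ^ 2 / 2) := by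
  have hs0 : (0 : ℝ) < s := by exact_mod_cast hs
  set q := √(s : ℝ) with hq
  have hq0 : 0 < q := Real.sqrt_pos.2 hs0
  have hq2 : q ^ 2 = s := Real.sq_sqrt hs0.le
  -- Chernoff parameter for which `1 - 2t = q/(q + a)`. Then `1 + a/q ≤ exp(a/q)` bounds the moment
  -- by `exp(aq/2)`, while the threshold contributes `exp(aq/2 + a²/2)`.
  set t := a / (2 * (q + a)) with ht
  have ht0 : 0 < t := by positivity
  have h12 : 1 - 2 * t = q / (q + a) := by rw [ht]; field_simp; ring
  have h12pos : 0 < 1 - 2 * t := by rw [h12]; positivity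
  have ht2 : t < 1 / 2 := by linarith
  have hint := integral_exp_mul_norm_sq_stdGaussian (E := E) ht2
  -- A nonintegrable function has integral `0` by convention, so a nonzero value proves
  -- integrability.
  have hne : ∫ x, Real.exp (t * ‖x‖ ^ 2) ∂stdGaussian E ≠ 0 := by
    rw [hint]; exact (pow_pos (inv_pos.2 (Real.sqrt_pos.2 h12pos)) _).ne'
  have hM := mul_meas_ge_le_integral_of_nonneg (μ := stdGaussian E)
    (Eventually.of_forall fun x => (Real.exp_pos (t * ‖x‖ ^ 2)).le)
    (Integrable.of_integral_ne_zero hne) (Real.exp (t * (q + a) ^ 2))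
  have hsub : {x : E | q + a ≤ ‖x‖} ⊆
      {x | Real.exp (t * (q + a) ^ 2) ≤ Real.exp (t * ‖x‖ ^ 2)} := by
    intro x hx
    simp only [Set.mem_ofPred_eq, Real.exp_le_exp] at hx ⊢
    gcongr
  have hbase : (√(1 - 2 * t))⁻¹ ≤ Real.exp (a / (2 * q)) := by
    rw [h12, ← Real.sqrt_inv, inv_div]
    have h1 : (q + a) / q ≤ Real.exp (a / (2 * q)) ^ 2 := by
      rw [← Real.exp_nat_mul]
      have := Real.add_one_le_exp (a / q)
      have e1 : (q + a) / q = a / q + 1 := by field_simp; ring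
      have e2 : ((2 : ℕ) : ℝ) * (a / (2 * q)) = a / q := by push_cast; field_simp
      rw [e1, e2]; exact this
    exact Real.sqrt_le_iff.2 ⟨(Real.exp_pos _).le, h1⟩
  have hpow : (√(1 - 2 * t))⁻¹ ^ Module.finrank ℝ E ≤ Real.exp (a * q / 2) := by
    calc (√(1 - 2 * t))⁻¹ ^ Module.finrank ℝ E
        ≤ Real.exp (a / (2 * q)) ^ Module.finrank ℝ E := by gcongr
      _ ≤ Real.exp (a / (2 * q)) ^ s :=
          pow_le_pow_right₀ (Real.one_le_exp (by positivity)) hd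
      _ = Real.exp (a * q / 2) := by
          rw [← Real.exp_nat_mul, ← hq2]; congr 1; field_simp
  have hcomb : Real.exp (t * (q + a) ^ 2) * (stdGaussian E).real {x | q + a ≤ ‖x‖} ≤
      Real.exp (a * q / 2) :=
    (mul_le_mul_of_nonneg_left (measureReal_mono hsub) (Real.exp_pos _).le).trans
      (hM.trans (hint.le.trans hpow))
  have hte : t * (q + a) ^ 2 = a * q / 2 + a ^ 2 / 2 := by rw [ht]; field_simp
  rw [hte, Real.exp_add, mul_assoc] at hcomb
  have h3 : Real.exp (a ^ 2 / 2) * (stdGaussian E).real {x | q + a ≤ ‖x‖} ≤ 1 := by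
    have := Real.exp_pos (a * q / 2)
    exact le_of_mul_le_mul_left (by linarith) this
  rw [neg_div, Real.exp_neg]
  rw [← one_div, le_div_iff₀ (Real.exp_pos _)]
  linarith

end StdGaussian

/-! ### Deviation bounds for the noise vector -/

variable {n : ℕ}

instance isProbabilityMeasure_gaussianNoise (σ : ℝ) :
    IsProbabilityMeasure (gaussianNoise n σ) := by
  unfold gaussianNoise; infer_instance

theorem gaussianNoise_eq_map {σ : ℝ} (hσ : 0 < σ) :
    gaussianNoise n σ = (stdGaussian (EuclideanSpace ℝ (Fin n))).map (fun x => σ • x) := by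
  have hS : (σ ^ 2 • (1 : Matrix (Fin n) (Fin n) ℝ)).PosSemidef :=
    Matrix.PosSemidef.one.smul (by positivity)
  apply Measure.ext_of_charFun
  ext t
  rw [gaussianNoise, charFun_multivariateGaussian hS, charFun_map_smul, charFun_stdGaussian]
  congr 1
  rw [norm_smul, Matrix.smul_mulVec, Matrix.one_mulVec, dotProduct_smul]
  have : (t.ofLp ⬝ᵥ t.ofLp : ℝ) = ‖t‖ ^ 2 := by
    rw [EuclideanSpace.real_norm_sq_eq]; simp [dotProduct, pow_two]
  rw [this, Real.norm_of_nonneg hσ.le]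
  simp [neg_div, mul_pow]

theorem gaussianNoise_real_eq {σ : ℝ} (hσ : 0 < σ) {S : Set (EuclideanSpace ℝ (Fin n))}
    (hS : MeasurableSet S) :
    (gaussianNoise n σ).real S =
      (stdGaussian (EuclideanSpace ℝ (Fin n))).real {x | σ • x ∈ S} := by
  rw [gaussianNoise_eq_map hσ, map_measureReal_apply (by fun_prop) hS]
  rfl

/-- The projection of the noise on a subspace of dimension at most `s`. -/
theorem gaussianNoise_norm_starProjection_gt_le {σ : ℝ} (hσ : 0 < σ) {s : ℕ} (hs : 1 ≤ s)
    (K : Submodule ℝ (EuclideanSpace ℝ (Fin n))) (hK : Module.finrank ℝ K ≤ s) :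
    (gaussianNoise n σ).real
      {x | σ * (√(s : ℝ) + 2 * √(Real.log 3)) < ‖K.starProjection x‖} ≤ 1 / 9 := by
  have hlog : 0 < Real.log 3 := Real.log_pos (by norm_num)
  rw [gaussianNoise_real_eq hσ (measurableSet_lt (by fun_prop) (by fun_prop))]
  have h := stdGaussian_norm_ge_le (E := K) hs hK (a := 2 * √(Real.log 3)) (by positivity)
  rw [← stdGaussian_map_orthogonalProjectionOnto, map_measureReal_apply (by fun_prop)
    (measurableSet_le (by fun_prop) (by fun_prop))] at h
  -- The offset `2√(log 3)` is what turns the tail `exp(-a²/2)` into `3⁻²`.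
  have he : Real.exp (-(2 * √(Real.log 3)) ^ 2 / 2) = 1 / 9 := by
    rw [mul_pow, Real.sq_sqrt hlog.le]
    rw [show -(2 ^ 2 * Real.log 3) / 2 = -(((2 : ℕ) : ℝ) * Real.log 3) by push_cast; ring,
      Real.exp_neg, Real.exp_nat_mul, Real.exp_log (by norm_num)]
    norm_num
  rw [he] at h
  refine (measureReal_mono ?_).trans h
  intro x hx
  simp only [Set.mem_ofPred_eq, Set.mem_preimage] at hx ⊢
  rw [map_smul, norm_smul, Real.norm_of_nonneg hσ.le] at hx
  have h2 := (lt_of_mul_lt_mul_left hx hσ.le).le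
  rwa [Submodule.starProjection_apply, ← Submodule.coe_norm] at h2

/-- A linear functional of the noise is nonnegative with probability at least `1 / 2`. -/
theorem half_le_gaussianNoise_inner_nonneg {σ : ℝ} (hσ : 0 < σ)
    (v : EuclideanSpace ℝ (Fin n)) :
    1 / 2 ≤ (gaussianNoise n σ).real {x | 0 ≤ ⟪x, v⟫} := by
  have hm : MeasurableSet {x : EuclideanSpace ℝ (Fin n) | 0 ≤ ⟪x, v⟫} :=
    measurableSet_le (by fun_prop) (by fun_prop)
  have hm' : MeasurableSet {x : EuclideanSpace ℝ (Fin n) | ⟪x, v⟫ ≤ 0} :=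
    measurableSet_le (by fun_prop) (by fun_prop)
  -- By symmetry the two closed half-spaces have equal mass, and they cover the space. This includes
  -- `v = 0`.
  have hsym : (gaussianNoise n σ).real {x | ⟪x, v⟫ ≤ 0} =
      (gaussianNoise n σ).real {x | 0 ≤ ⟪x, v⟫} := by
    rw [gaussianNoise_real_eq hσ hm, gaussianNoise_real_eq hσ hm']
    have hneg := stdGaussian_map (LinearIsometryEquiv.neg ℝ (E := EuclideanSpace ℝ (Fin n)))
    have hm2 : MeasurableSet
        {x : EuclideanSpace ℝ (Fin n) | σ • x ∈ {x : EuclideanSpace ℝ (Fin n) | 0 ≤ ⟪x, v⟫}} :=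
      hm.preimage (f := fun x => σ • x) (by fun_prop)
    conv_rhs => rw [← hneg, map_measureReal_apply (by fun_prop) hm2]
    congr 1
    ext x
    simp
  have hU : {x : EuclideanSpace ℝ (Fin n) | ⟪x, v⟫ ≤ 0} ∪ {x | 0 ≤ ⟪x, v⟫} = Set.univ := by
    ext x; simpa using le_total _ _
  have h := measureReal_union_le (μ := gaussianNoise n σ)
    {x : EuclideanSpace ℝ (Fin n) | ⟪x, v⟫ ≤ 0} {x | 0 ≤ ⟪x, v⟫}
  rw [hU, hsym, probReal_univ] at h
  linarith

theorem integrable_and_integral_exp_inner {σ : ℝ} (hσ : 0 < σ)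
    (v : EuclideanSpace ℝ (Fin n)) :
    Integrable (fun x => Real.exp ⟪v, x⟫) (gaussianNoise n σ) ∧
      ∫ x, Real.exp ⟪v, x⟫ ∂gaussianNoise n σ = Real.exp (σ ^ 2 * ‖v‖ ^ 2 / 2) := by
  have hI : ∫ x, Real.exp ⟪v, x⟫ ∂gaussianNoise n σ = Real.exp (σ ^ 2 * ‖v‖ ^ 2 / 2) := by
    rw [gaussianNoise_eq_map hσ, integral_map (by fun_prop)
      (Measurable.aestronglyMeasurable (by fun_prop))]
    have hL := IsGaussian.map_eq_gaussianReal
      (μ := stdGaussian (EuclideanSpace ℝ (Fin n))) (innerSL ℝ v)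
    rw [integral_strongDual_stdGaussian, variance_dual_stdGaussian, innerSL_apply_norm] at hL
    have h := mgf_gaussianReal hL σ
    rw [mgf] at h
    simp only [innerSL_apply_apply] at h
    simp only [inner_smul_right]
    rw [h, Real.coe_toNNReal _ (by positivity)]
    ring_nf
  exact ⟨Integrable.of_integral_ne_zero (by rw [hI]; exact (Real.exp_pos _).ne'), hI⟩

/-- From `x²/2 ≤ eˣ` at `x = θ(|z| - τ) ≥ 0`; the right-hand side has a Gaussian expectation in
closed form. -/
theorem sq_max_sub_le {θ : ℝ} (hθ : 0 < θ) (τ z : ℝ) :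
    (max (|z| - τ) 0) ^ 2 ≤
      2 / θ ^ 2 * Real.exp (-(θ * τ)) * (Real.exp (θ * z) + Real.exp (-(θ * z))) := by
  have hexp : Real.exp (θ * |z|) ≤ Real.exp (θ * z) + Real.exp (-(θ * z)) := by
    rcases abs_cases z with ⟨h, _⟩ | ⟨h, _⟩ <;> rw [h]
    · linarith [Real.exp_pos (-(θ * z))]
    · rw [mul_neg]; linarith [Real.exp_pos (θ * z)]
  rcases le_total (|z| - τ) 0 with h | h
  · rw [max_eq_right h, zero_pow two_ne_zero]; positivity
  · rw [max_eq_left h]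
    have h1 := Real.quadratic_le_exp_of_nonneg (mul_nonneg hθ.le h)
    have h2 : (θ * (|z| - τ)) ^ 2 / 2 ≤ Real.exp (θ * (|z| - τ)) := by
      have := mul_nonneg hθ.le h
      linarith
    calc (|z| - τ) ^ 2 = 2 / θ ^ 2 * ((θ * (|z| - τ)) ^ 2 / 2) := by field_simp
      _ ≤ 2 / θ ^ 2 * Real.exp (θ * (|z| - τ)) := by gcongr
      _ = 2 / θ ^ 2 * Real.exp (-(θ * τ)) * Real.exp (θ * |z|) := by
          rw [mul_assoc, ← Real.exp_add]; ring_nf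
      _ ≤ _ := by gcongr

/-- The excesses of `p` Gaussian variables `⟪v j, x⟫` of variance at most `w²` over the level
`τ`. -/
theorem gaussianNoise_sum_sq_excess_ge_le {σ : ℝ} (hσ : 0 < σ) {ι : Type*} [Fintype ι]
    (v : ι → EuclideanSpace ℝ (Fin n)) {w τ : ℝ} (hw : 0 < w) (hτ : 0 < τ)
    (hv : ∀ j, σ * ‖v j‖ ≤ w) {R : ℝ} (hR : 0 < R) :
    (gaussianNoise n σ).real {x | R < ∑ j, (max (|⟪v j, x⟫| - τ) 0) ^ 2} ≤
      Fintype.card ι * (4 * w ^ 4 / τ ^ 2 * Real.exp (-(τ ^ 2 / (2 * w ^ 2)))) / R := by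
  -- This minimizes the exponent `-θτ + θ²w²/2`, with value `-τ²/(2w²)`.
  set θ := τ / w ^ 2 with hθ
  have hθ0 : 0 < θ := by positivity
  set f : ι → EuclideanSpace ℝ (Fin n) → ℝ := fun j x =>
    2 / θ ^ 2 * Real.exp (-(θ * τ)) * (Real.exp ⟪θ • v j, x⟫ + Real.exp ⟪-(θ • v j), x⟫) with hf
  have hfi : ∀ j, Integrable (f j) (gaussianNoise n σ) := fun j =>
    (((integrable_and_integral_exp_inner hσ _).1.add
      (integrable_and_integral_exp_inner hσ _).1).const_mul _)
  have hfI : ∀ j, ∫ x, f j x ∂gaussianNoise n σ ≤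
      4 * w ^ 4 / τ ^ 2 * Real.exp (-(τ ^ 2 / (2 * w ^ 2))) := by
    intro j
    rw [hf]
    simp only
    rw [integral_const_mul, integral_add (integrable_and_integral_exp_inner hσ _).1
      (integrable_and_integral_exp_inner hσ _).1, (integrable_and_integral_exp_inner hσ _).2,
      (integrable_and_integral_exp_inner hσ _).2, norm_neg, norm_smul,
      Real.norm_of_nonneg hθ0.le]
    have h1 : σ ^ 2 * (θ * ‖v j‖) ^ 2 / 2 ≤ τ ^ 2 / (2 * w ^ 2) := by
      have h2 : (σ * ‖v j‖) ^ 2 ≤ w ^ 2 := by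
        have := hv j
        gcongr
      calc σ ^ 2 * (θ * ‖v j‖) ^ 2 / 2 = θ ^ 2 / 2 * (σ * ‖v j‖) ^ 2 := by ring
        _ ≤ θ ^ 2 / 2 * w ^ 2 := by gcongr
        _ = τ ^ 2 / (2 * w ^ 2) := by rw [hθ]; field_simp
    have h3 := Real.exp_le_exp.2 h1
    calc 2 / θ ^ 2 * Real.exp (-(θ * τ)) * (Real.exp (σ ^ 2 * (θ * ‖v j‖) ^ 2 / 2) +
          Real.exp (σ ^ 2 * (θ * ‖v j‖) ^ 2 / 2))
        ≤ 2 / θ ^ 2 * Real.exp (-(θ * τ)) * (Real.exp (τ ^ 2 / (2 * w ^ 2)) +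
          Real.exp (τ ^ 2 / (2 * w ^ 2))) := by gcongr
      _ = 4 / θ ^ 2 * (Real.exp (-(θ * τ)) * Real.exp (τ ^ 2 / (2 * w ^ 2))) := by ring
      _ = 4 * w ^ 4 / τ ^ 2 * Real.exp (-(τ ^ 2 / (2 * w ^ 2))) := by
          rw [← Real.exp_add]
          congr 1
          · rw [hθ]; field_simp
          · congr 1; rw [hθ]; field_simp; ring
  have hf0 : ∀ j x, 0 ≤ f j x := fun j x => by positivity
  have hM := mul_meas_ge_le_integral_of_nonneg (μ := gaussianNoise n σ)
    (f := fun x => ∑ j, f j x)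
    (Eventually.of_forall fun x => Finset.sum_nonneg fun j _ => hf0 j x)
    (integrable_finsetSum _ fun j _ => hfi j) R
  rw [integral_finsetSum _ fun j _ => hfi j] at hM
  have hsum : ∑ j, ∫ x, f j x ∂gaussianNoise n σ ≤
      Fintype.card ι * (4 * w ^ 4 / τ ^ 2 * Real.exp (-(τ ^ 2 / (2 * w ^ 2)))) := by
    refine (Finset.sum_le_sum fun j _ => hfI j).trans ?_
    simp
  have hsub : {x | R < ∑ j, (max (|⟪v j, x⟫| - τ) 0) ^ 2} ⊆ {x | R ≤ ∑ j, f j x} := by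
    intro x hx
    simp only [Set.mem_ofPred_eq] at hx ⊢
    refine hx.le.trans (Finset.sum_le_sum fun j _ => ?_)
    have := sq_max_sub_le hθ0 τ ⟪v j, x⟫
    rw [hf]
    simpa only [inner_neg_left, real_inner_smul_left] using this
  rw [le_div_iff₀ hR, mul_comm]
  exact (mul_le_mul_of_nonneg_left (measureReal_mono hsub) hR.le).trans (hM.trans hsum)


/-! ### The design constants -/

section Design

variable {n p : ℕ} (X : Matrix (Fin n) (Fin p) ℝ)

/-- Exchange argument: the two sets have equal size, so their differences do too, and the value at
index `s` separates the entries of one difference from those of the other. -/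
theorem sum_antitone_tail_le {p : ℕ} {a : Fin p → ℝ} (ha : Antitone a) {s : ℕ}
    (B : Finset (Fin p)) (hB : B.card = p - s) (ha0 : ∀ j, 0 ≤ a j) :
    ∑ j ∈ Finset.univ.filter (fun j : Fin p => s ≤ j.val), a j ≤ ∑ j ∈ B, a j := by
  rcases lt_or_ge s p with hsp | hsp
  · set A := Finset.univ.filter (fun j : Fin p => s ≤ j.val) with hA
    have hcard : A.card = p - s := by
      have : A = Finset.Ici (⟨s, hsp⟩ : Fin p) := by ext j; simp [hA, Fin.le_def]
      rw [this, Fin.card_Ici]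
    set m := a ⟨s, hsp⟩
    have h1 : ∑ j ∈ A \ B, a j ≤ (A \ B).card * m := by
      rw [← nsmul_eq_mul]
      refine Finset.sum_le_card_nsmul _ _ _ fun j hj => ha ?_
      simpa [hA, Fin.le_def] using (Finset.mem_sdiff.1 hj).1
    have h2 : (B \ A).card * m ≤ ∑ j ∈ B \ A, a j := by
      rw [← nsmul_eq_mul]
      refine Finset.card_nsmul_le_sum _ _ _ fun j hj => ha ?_
      have : ¬ s ≤ j.val := by simpa [hA] using (Finset.mem_sdiff.1 hj).2
      exact Fin.le_def.2 (not_le.1 this).le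
    have h3 : (A \ B).card = (B \ A).card := by
      have e1 := Finset.card_sdiff_add_card_inter A B
      have e2 := Finset.card_sdiff_add_card_inter B A
      rw [Finset.inter_comm] at e2
      omega
    rw [h3] at h1
    have e1 := Finset.sum_inter_add_sum_sdiff A B a
    have e2 := Finset.sum_inter_add_sum_sdiff B A a
    rw [Finset.inter_comm] at e2
    linarith
  · have : Finset.univ.filter (fun j : Fin p => s ≤ j.val) = ∅ := by
      ext j; simp; omega
    rw [this, Finset.sum_empty]
    exact Finset.sum_nonneg fun j _ => ha0 j

theorem tailSum_card_le (α : EuclideanSpace ℝ (Fin p)) (T : Finset (Fin p)) :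
    tailSum T.card α ≤ ∑ j ∈ Tᶜ, |α j| := by
  set π := Tuple.sort (fun i => -|α i|)
  have h := sum_antitone_tail_le (absRearr_antitone α) (s := T.card)
    (Tᶜ.map π.symm.toEmbedding) (by simp [Finset.card_compl]) fun j => abs_nonneg _
  refine h.trans (le_of_eq ?_)
  rw [Finset.sum_map]
  simp [absRearr, π]

theorem le_toEuclideanLin_of_tailSum_le {c : ℝ} {s : ℕ}
    {α : EuclideanSpace ℝ (Fin p)} (hα : tailSum s α ≤ c * √(s : ℝ) * ‖α‖) (hn : 0 < n) :
    reConst X c s * (√(n : ℝ) * ‖α‖) ≤ ‖X.toEuclideanLin α‖ := by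
  rcases eq_or_ne α 0 with rfl | h0
  · simp
  · have hpos : 0 < √(n : ℝ) * ‖α‖ :=
      mul_pos (Real.sqrt_pos.2 (by exact_mod_cast hn)) (norm_pos_iff.2 h0)
    rw [← le_div_iff₀ hpos]
    refine csInf_le ⟨0, ?_⟩ ⟨α, h0, hα, rfl⟩
    rintro r ⟨β, -, -, rfl⟩
    positivity

/-- For `n = 0` every quotient is `0` because division by zero gives `0`, and the infimum of the
empty set is `0` as well. -/
theorem pos_of_reConst_pos {c : ℝ} {s : ℕ} (h : 0 < reConst X c s) : 0 < n := by
  by_contra hn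
  obtain rfl : n = 0 := by omega
  have : reConst X c s ≤ 0 := by
    refine Real.sInf_nonpos ?_
    rintro r ⟨β, -, -, rfl⟩
    simp
  linarith

/-- The upper isometry inequality passes to the infimum; the lower one is never needed. The
admissible set is nonempty: for `δ = 1 + ‖X‖/√n` the lower inequality is trivial. -/
theorem ripConst_spec (s : ℕ) :
    0 ≤ ripConst X s ∧ ∀ β : EuclideanSpace ℝ (Fin p), sparsity β ≤ s →
      1 / √(n : ℝ) * ‖X.toEuclideanLin β‖ ≤ (1 + ripConst X s) * ‖β‖ := by
  refine ⟨Real.sInf_nonneg fun δ hδ => hδ.1, fun β hβ => ?_⟩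
  set L := LinearMap.toContinuousLinearMap X.toEuclideanLin
  have hL : ∀ β, 1 / √(n : ℝ) * ‖X.toEuclideanLin β‖ ≤ 1 / √(n : ℝ) * ‖L‖ * ‖β‖ := fun β => by
    rw [mul_assoc]
    exact mul_le_mul_of_nonneg_left (L.le_opNorm β) (by positivity)
  have hne : {δ : ℝ | 0 ≤ δ ∧ ∀ β : EuclideanSpace ℝ (Fin p), sparsity β ≤ s →
      (1 - δ) * ‖β‖ ≤ 1 / √(n : ℝ) * ‖X.toEuclideanLin β‖ ∧
      1 / √(n : ℝ) * ‖X.toEuclideanLin β‖ ≤ (1 + δ) * ‖β‖}.Nonempty := by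
    refine ⟨1 + 1 / √(n : ℝ) * ‖L‖, by positivity, fun β _ => ⟨?_, (hL β).trans ?_⟩⟩
    · refine le_trans (mul_nonpos_of_nonpos_of_nonneg ?_ (norm_nonneg _)) (by positivity)
      have : 0 ≤ 1 / √(n : ℝ) * ‖L‖ := by positivity
      linarith
    · exact mul_le_mul_of_nonneg_right (by linarith) (norm_nonneg _)
  refine le_of_forall_pos_le_add fun e he => ?_
  have he' : 0 < e / (‖β‖ + 1) := by positivity
  obtain ⟨δ, hδ, hlt⟩ := Real.lt_sInf_add_pos hne he'
  have h1 : δ < ripConst X s + e / (‖β‖ + 1) := hlt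
  have h2 : e / (‖β‖ + 1) * ‖β‖ ≤ e := by
    rw [div_mul_eq_mul_div, div_le_iff₀ (by positivity)]
    nlinarith [norm_nonneg β]
  have h3 := mul_le_mul_of_nonneg_right h1.le (norm_nonneg β)
  linarith [(hδ.2 β hβ).2]

theorem norm_toEuclideanLin_le_of_sparsity_le (hn : 0 < n) {s : ℕ}
    {β : EuclideanSpace ℝ (Fin p)} (hβ : sparsity β ≤ s) :
    ‖X.toEuclideanLin β‖ ≤ √(n : ℝ) * ((1 + ripConst X s) * ‖β‖) := by
  have h := (ripConst_spec X s).2 β hβ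
  have hn' : 0 < √(n : ℝ) := Real.sqrt_pos.2 (by exact_mod_cast hn)
  rwa [one_div, inv_mul_le_iff₀ hn'] at h

theorem sparsity_single_le (j : Fin p) : sparsity (EuclideanSpace.single j (1 : ℝ)) ≤ 1 := by
  refine (Finset.card_le_card (t := {j}) fun i hi => ?_).trans (Finset.card_singleton j).le
  by_contra hij
  simp_all

theorem norm_column_le (hn : 0 < n) {s : ℕ} (hs : 1 ≤ s) (j : Fin p) :
    ‖X.toEuclideanLin (EuclideanSpace.single j 1)‖ ≤ √(n : ℝ) * (1 + ripConst X s) := by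
  have h := norm_toEuclideanLin_le_of_sparsity_le X hn ((sparsity_single_le j).trans hs)
  simpa using h

theorem toEuclideanLin_eq_sum (u : EuclideanSpace ℝ (Fin p)) :
    X.toEuclideanLin u = ∑ j, u j • X.toEuclideanLin (EuclideanSpace.single j 1) := by
  have h : u = ∑ j, u j • EuclideanSpace.single j (1 : ℝ) := by
    ext i; simp [Finset.sum_apply, Pi.single_apply]
  conv_lhs => rw [h]
  simp only [map_sum, map_smul]

end Design

/-! ### Deterministic properties of the Lasso -/

section Deterministic

variable {n p : ℕ} (X : Matrix (Fin n) (Fin p) ℝ)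

theorem l1Norm_convex_comb_le (a b : EuclideanSpace ℝ (Fin p)) {t : ℝ} (ht0 : 0 ≤ t)
    (ht1 : t ≤ 1) : l1Norm (a + t • (b - a)) ≤ (1 - t) * l1Norm a + t * l1Norm b := by
  unfold l1Norm
  rw [Finset.mul_sum, Finset.mul_sum, ← Finset.sum_add_distrib]
  refine Finset.sum_le_sum fun j _ => ?_
  have : (a + t • (b - a)) j = (1 - t) * a j + t * b j := by simp; ring
  rw [this]
  refine (abs_add_le _ _).trans (le_of_eq ?_)
  rw [abs_mul, abs_mul, abs_of_nonneg ht0, abs_of_nonneg (sub_nonneg.2 ht1)]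

/-- The first order condition for a Lasso solution `b`, tested against `c`. -/
theorem IsLasso.inner_le {lam : ℝ} (hlam : 0 ≤ lam) {y : EuclideanSpace ℝ (Fin n)}
    {b : EuclideanSpace ℝ (Fin p)} (hb : IsLasso X lam y b) (c : EuclideanSpace ℝ (Fin p)) :
    ⟪X.toEuclideanLin b - y, X.toEuclideanLin (b - c)⟫ ≤
      lassoPenalty n lam c - lassoPenalty n lam b := by
  set r := X.toEuclideanLin b - y with hr
  set d := X.toEuclideanLin (b - c) with hd
  set Δ := lassoPenalty n lam c - lassoPenalty n lam b with hΔ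
  -- Minimality is compared at `b + t(c - b)`: the penalty is convex, the square loss is expanded,
  -- and the inequality is divided by `t` before letting `t → 0`.
  have key : ∀ t : ℝ, 0 < t → t ≤ 1 → 2 * (⟪r, d⟫ - Δ) ≤ t * ‖d‖ ^ 2 := by
    intro t ht0 ht1
    have h := hb (b + t • (c - b))
    have e1 : X.toEuclideanLin (b + t • (c - b)) - y = r - t • d := by
      rw [hr, hd]; simp only [map_add, map_smul, map_sub, smul_sub]; abel
    have hpen : lassoPenalty n lam (b + t • (c - b)) ≤ lassoPenalty n lam b + t * Δ := by
      have := mul_le_mul_of_nonneg_left (l1Norm_convex_comb_le b c ht0.le ht1)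
        (mul_nonneg (Real.sqrt_nonneg (n : ℝ)) hlam)
      rw [hΔ]; unfold lassoPenalty; linarith
    rw [e1, ← hr, norm_sub_sq_real r, norm_smul, inner_smul_right, mul_pow,
      Real.norm_of_nonneg ht0.le] at h
    have h2 : t * (2 * (⟪r, d⟫ - Δ)) ≤ t * (t * ‖d‖ ^ 2) := by nlinarith
    exact le_of_mul_le_mul_left h2 ht0
  have hlim : Tendsto (fun t : ℝ => t * ‖d‖ ^ 2) (𝓝[>] 0) (𝓝 0) := by
    have : Tendsto (fun t : ℝ => t * ‖d‖ ^ 2) (𝓝 0) (𝓝 (0 * ‖d‖ ^ 2)) :=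
      tendsto_id.mul_const _
    rw [zero_mul] at this
    exact this.mono_left nhdsWithin_le_nhds
  have h0 : 2 * (⟪r, d⟫ - Δ) ≤ 0 := by
    refine ge_of_tendsto hlim ?_
    filter_upwards [Ioc_mem_nhdsGT (zero_lt_one' ℝ)] with t ht
    exact key t ht.1 ht.2
  linarith

/-- The support of a vector. -/
noncomputable def support (β : EuclideanSpace ℝ (Fin p)) : Finset (Fin p) :=
  Finset.univ.filter fun j => β j ≠ 0

/-- The span of the columns of `X` indexed by the support of `β`. -/
noncomputable def columnSpan (β : EuclideanSpace ℝ (Fin p)) :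
    Submodule ℝ (EuclideanSpace ℝ (Fin n)) :=
  Submodule.span ℝ
    ((support β).image fun j => X.toEuclideanLin (EuclideanSpace.single j 1) :
      Finset (EuclideanSpace ℝ (Fin n)))

theorem finrank_columnSpan_le (β : EuclideanSpace ℝ (Fin p)) :
    Module.finrank ℝ (columnSpan X β) ≤ sparsity β :=
  (finrank_span_finset_le_card _).trans Finset.card_image_le

/-- The normalized columns of `X`, projected on the orthogonal complement of `columnSpan X β`. -/
noncomputable def residualColumn (β : EuclideanSpace ℝ (Fin p)) (j : Fin p) :
    EuclideanSpace ℝ (Fin n) :=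
  (√(n : ℝ))⁻¹ • (X.toEuclideanLin (EuclideanSpace.single j 1) -
    (columnSpan X β).starProjection (X.toEuclideanLin (EuclideanSpace.single j 1)))

theorem residualColumn_eq_zero {β : EuclideanSpace ℝ (Fin p)} {j : Fin p} (hj : j ∈ support β) :
    residualColumn X β j = 0 := by
  have : X.toEuclideanLin (EuclideanSpace.single j 1) ∈ columnSpan X β :=
    Submodule.subset_span (Finset.mem_coe.2 (Finset.mem_image_of_mem _ hj))
  rw [residualColumn, Submodule.starProjection_eq_self_iff.2 this, sub_self, smul_zero]

theorem norm_residualColumn_le (hn : 0 < n) {s : ℕ} (hs : 1 ≤ s) (β : EuclideanSpace ℝ (Fin p))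
    (j : Fin p) : ‖residualColumn X β j‖ ≤ 1 + ripConst X s := by
  have hn' : 0 < √(n : ℝ) := Real.sqrt_pos.2 (by exact_mod_cast hn)
  rw [residualColumn, norm_smul, norm_inv, Real.norm_of_nonneg hn'.le, inv_mul_le_iff₀ hn']
  refine le_trans ?_ (norm_column_le X hn hs j)
  set x := X.toEuclideanLin (EuclideanSpace.single j 1)
  have h := (columnSpan X β).norm_sq_eq_add_norm_sq_starProjection x
  rw [Submodule.starProjection_orthogonal_val] at h
  exact le_of_sq_le_sq (by nlinarith [sq_nonneg ‖(columnSpan X β).starProjection x‖])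
    (norm_nonneg _)

/-- Split `e` along the column span and its complement. In the complement only columns off the
support survive, and each correlation is at most `τ` plus its excess: the `τ` part pairs with the
`ℓ¹` norm, the excesses with `‖u‖` by Cauchy–Schwarz. -/
theorem inner_toEuclideanLin_le (hn : 0 < n) (β u : EuclideanSpace ℝ (Fin p))
    (e : EuclideanSpace ℝ (Fin n)) {τ r : ℝ} (hr : 0 ≤ r)
    (hB : ∑ j, (max (|⟪residualColumn X β j, e⟫| - τ) 0) ^ 2 ≤ r ^ 2) :
    ⟪e, X.toEuclideanLin u⟫ ≤
      ‖(columnSpan X β).starProjection e‖ * ‖X.toEuclideanLin u‖ +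
        √(n : ℝ) * (τ * ∑ j ∈ (support β)ᶜ, |u j| + r * ‖u‖) := by
  set K := columnSpan X β
  have hn' : 0 < √(n : ℝ) := Real.sqrt_pos.2 (by exact_mod_cast hn)
  have e1 : ⟪e, X.toEuclideanLin u⟫ = ⟪K.starProjection e, X.toEuclideanLin u⟫ +
      √(n : ℝ) * ∑ j, u j * ⟪residualColumn X β j, e⟫ := by
    have h1 : ⟪e, X.toEuclideanLin u - K.starProjection (X.toEuclideanLin u)⟫ =
        √(n : ℝ) * ∑ j, u j * ⟪residualColumn X β j, e⟫ := by
      rw [toEuclideanLin_eq_sum X u, map_sum, ← Finset.sum_sub_distrib, inner_sum,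
        Finset.mul_sum]
      refine Finset.sum_congr rfl fun j _ => ?_
      rw [map_smul, ← smul_sub, inner_smul_right, residualColumn, real_inner_smul_left,
        real_inner_comm, ← mul_assoc, mul_comm (√(n : ℝ)), mul_assoc,
        mul_inv_cancel_left₀ hn'.ne']
    rw [← h1, inner_sub_right, Submodule.inner_starProjection_left_eq_right]
    ring
  have e2 : ∑ j, u j * ⟪residualColumn X β j, e⟫ =
      ∑ j ∈ (support β)ᶜ, u j * ⟪residualColumn X β j, e⟫ := by
    symm
    refine Finset.sum_subset (Finset.subset_univ _) fun j _ hj => ?_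
    rw [residualColumn_eq_zero X (by simpa using hj), inner_zero_left, mul_zero]
  have e3 : ∑ j ∈ (support β)ᶜ, u j * ⟪residualColumn X β j, e⟫ ≤
      τ * ∑ j ∈ (support β)ᶜ, |u j| +
        ∑ j, |u j| * max (|⟪residualColumn X β j, e⟫| - τ) 0 := by
    rw [Finset.mul_sum]
    refine le_trans ?_ (add_le_add_right (Finset.sum_le_sum_of_subset_of_nonneg
      (Finset.subset_univ (support β)ᶜ) fun j _ _ => by positivity) _)
    rw [← Finset.sum_add_distrib]
    refine Finset.sum_le_sum fun j _ => ?_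
    refine (le_abs_self _).trans ?_
    rw [abs_mul]
    have := mul_le_mul_of_nonneg_left
      (le_max_left (|⟪residualColumn X β j, e⟫| - τ) 0) (abs_nonneg (u j))
    linarith
  have e4 : ∑ j, |u j| * max (|⟪residualColumn X β j, e⟫| - τ) 0 ≤ ‖u‖ * r := by
    refine (Real.sum_mul_le_sqrt_mul_sqrt _ _ _).trans ?_
    have h1 : √(∑ j, |u j| ^ 2) = ‖u‖ := by
      rw [EuclideanSpace.norm_eq]; simp
    rw [h1]
    exact mul_le_mul_of_nonneg_left (Real.sqrt_le_iff.2 ⟨hr, hB⟩) (norm_nonneg _)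
  rw [e1, e2]
  refine add_le_add (real_inner_le_norm _ _) (mul_le_mul_of_nonneg_left ?_ hn'.le)
  linarith

/-- Triangle inequality and Cauchy–Schwarz on the support; off it `β` vanishes and `u` is paid in
full. -/
theorem l1Norm_sub_l1Norm_add_le (β u : EuclideanSpace ℝ (Fin p)) :
    l1Norm β - l1Norm (β + u) ≤
      √(sparsity β : ℝ) * ‖u‖ - ∑ j ∈ (support β)ᶜ, |u j| := by
  have h1 : l1Norm β - l1Norm (β + u) ≤
      ∑ j ∈ support β, |u j| - ∑ j ∈ (support β)ᶜ, |u j| := by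
    unfold l1Norm
    rw [← Finset.sum_sub_distrib, ← Finset.sum_add_sum_compl (support β), sub_eq_add_neg,
      ← Finset.sum_neg_distrib]
    refine add_le_add (Finset.sum_le_sum fun j _ => ?_) (Finset.sum_le_sum fun j hj => ?_)
    · have := abs_sub_abs_le_abs_sub (β j) ((β + u) j)
      simpa using this
    · have : β j = 0 := by simpa [support] using hj
      simp [this]
  have h2 : ∑ j ∈ support β, |u j| ≤ √(sparsity β : ℝ) * ‖u‖ := by
    have h := Real.sum_mul_le_sqrt_mul_sqrt (support β) (fun _ => (1 : ℝ)) fun j => |u j|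
    simp only [one_mul, one_pow, Finset.sum_const, nsmul_eq_mul, mul_one] at h
    refine h.trans (mul_le_mul_of_nonneg_left ?_ (Real.sqrt_nonneg _))
    rw [EuclideanSpace.norm_eq]
    refine Real.sqrt_le_sqrt ?_
    simp only [Real.norm_eq_abs]
    exact Finset.sum_le_sum_of_subset_of_nonneg (Finset.subset_univ _) fun j _ _ => by positivity
  linarith

theorem logTerm_ge_one {s : ℕ} (hs : 1 ≤ s) (hsp : s ≤ p) : 1 ≤ logTerm p s := by
  have hs0 : (0 : ℝ) < s := by exact_mod_cast hs
  have hsp' : (s : ℝ) ≤ p := by exact_mod_cast hsp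
  rw [logTerm, Real.le_log_iff_exp_le (by have := hs0.trans_le hsp'; positivity),
    le_div_iff₀ hs0]
  have := Real.exp_pos 1
  have h1 : Real.exp 1 * s ≤ Real.exp 1 * p := by gcongr
  nlinarith

theorem sparsity_le (β : EuclideanSpace ℝ (Fin p)) : sparsity β ≤ p :=
  (Finset.card_le_univ _).trans (Fintype.card_fin p).le

end Deterministic


/-! ### The favourable noise event -/

section Event

variable {n p : ℕ} (X : Matrix (Fin n) (Fin p) ℝ)

/-- The level `σ (1 + δ_s)` of the noise in the direction of a normalized column of `X`. -/
noncomputable def columnLevel (β : EuclideanSpace ℝ (Fin p)) (σ : ℝ) : ℝ :=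
  σ * (1 + ripConst X (sparsity β))

/-- The noise vectors for which both the projection on `columnSpan X β` and the correlations
with the residual columns are under control. -/
def goodNoise (β : EuclideanSpace ℝ (Fin p)) (σ : ℝ) : Set (EuclideanSpace ℝ (Fin n)) :=
  {e | ‖(columnSpan X β).starProjection e‖ ≤ σ * (√(sparsity β : ℝ) + 2 * √(Real.log 3)) ∧
    ∑ j, (max (|⟪residualColumn X β j, e⟫| -
      columnLevel X β σ * √(2 * logTerm p (sparsity β))) 0) ^ 2 ≤
        6 * columnLevel X β σ ^ 2 * sparsity β}

theorem columnLevel_pos (β : EuclideanSpace ℝ (Fin p)) {σ : ℝ} (hσ : 0 < σ) :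
    0 < columnLevel X β σ :=
  mul_pos hσ (by linarith [(ripConst_spec X (sparsity β)).1])

theorem measurableSet_goodNoise (β : EuclideanSpace ℝ (Fin p)) (σ : ℝ) :
    MeasurableSet (goodNoise X β σ) := by
  have hA : MeasurableSet {e | ‖(columnSpan X β).starProjection e‖ ≤
      σ * (√(sparsity β : ℝ) + 2 * √(Real.log 3))} :=
    measurableSet_le (by fun_prop) (by fun_prop)
  have hB : MeasurableSet {e | ∑ j, (max (|⟪residualColumn X β j, e⟫| -
      columnLevel X β σ * √(2 * logTerm p (sparsity β))) 0) ^ 2 ≤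
        6 * columnLevel X β σ ^ 2 * sparsity β} :=
    measurableSet_le (Continuous.measurable (by fun_prop)) (by fun_prop)
  exact hA.inter hB

theorem gaussianNoise_goodNoise_compl_le (hn : 0 < n) {β : EuclideanSpace ℝ (Fin p)}
    (hs : 1 ≤ sparsity β) {σ : ℝ} (hσ : 0 < σ) :
    (gaussianNoise n σ).real (goodNoise X β σ)ᶜ ≤ 4 / 27 := by
  set s := sparsity β with hsdef
  set w := columnLevel X β σ with hw
  set L := logTerm p s with hL
  have hw0 : 0 < w := columnLevel_pos X β hσ
  have hsp : s ≤ p := sparsity_le β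
  have hL1 : 1 ≤ L := logTerm_ge_one hs hsp
  have hs0 : (0 : ℝ) < s := by exact_mod_cast hs
  have hp0 : (0 : ℝ) < p := by exact_mod_cast hs.trans hsp
  have hA := gaussianNoise_norm_starProjection_gt_le hσ hs (columnSpan X β)
    (finrank_columnSpan_le X β)
  have hv : ∀ j, σ * ‖residualColumn X β j‖ ≤ w := fun j =>
    mul_le_mul_of_nonneg_left (norm_residualColumn_le X hn hs β j) hσ.le
  have hB := gaussianNoise_sum_sq_excess_ge_le hσ (residualColumn X β) hw0
    (τ := w * √(2 * L)) (by positivity) hv (R := 6 * w ^ 2 * s) (by positivity)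
  have hB' : (Fintype.card (Fin p) : ℝ) * (4 * w ^ 4 / (w * √(2 * L)) ^ 2 *
      Real.exp (-((w * √(2 * L)) ^ 2 / (2 * w ^ 2)))) / (6 * w ^ 2 * s) ≤ 1 / 27 := by
    have e1 : (w * √(2 * L)) ^ 2 = 2 * w ^ 2 * L := by
      rw [mul_pow, Real.sq_sqrt (by positivity)]; ring
    have e2 : 2 * w ^ 2 * L / (2 * w ^ 2) = L := by field_simp
    have he := Real.exp_pos 1
    -- The logarithm is chosen so that the number `p` of columns cancels in Markov's bound, leaving
    -- `1/(27eL)`.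
    have e3 : Real.exp (-L) = s / (9 * Real.exp 1 * p) := by
      rw [hL, logTerm, Real.exp_neg, Real.exp_log (by positivity), inv_div]
    rw [e1, e2, e3, Fintype.card_fin]
    have e4 : (p : ℝ) * (4 * w ^ 4 / (2 * w ^ 2 * L) * (s / (9 * Real.exp 1 * p))) /
        (6 * w ^ 2 * s) = 1 / (27 * (Real.exp 1 * L)) := by
      field_simp; norm_num
    rw [e4]
    have : 1 ≤ Real.exp 1 * L := one_le_mul_of_one_le_of_one_le (Real.one_le_exp zero_le_one) hL1
    exact one_div_le_one_div_of_le (by norm_num) (by linarith)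
  have hsub : (goodNoise X β σ)ᶜ ⊆
      {x | σ * (√(s : ℝ) + 2 * √(Real.log 3)) < ‖(columnSpan X β).starProjection x‖} ∪
      {x | 6 * w ^ 2 * s < ∑ j, (max (|⟪residualColumn X β j, x⟫| - w * √(2 * L)) 0) ^ 2} := by
    intro x hx
    by_contra h
    rw [Set.mem_union, not_or] at h
    exact hx ⟨not_lt.1 h.1, not_lt.1 h.2⟩
  have := (measureReal_mono hsub).trans (measureReal_union_le (μ := gaussianNoise n σ) _ _)
  linarith

theorem le_gaussianNoise_goodNoise (hn : 0 < n) {β : EuclideanSpace ℝ (Fin p)}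
    (hs : 1 ≤ sparsity β) {σ : ℝ} (hσ : 0 < σ) :
    0.76 ≤ (gaussianNoise n σ).real (goodNoise X β σ) := by
  have h := gaussianNoise_goodNoise_compl_le X hn hs hσ
  rw [probReal_compl_eq_one_sub (measurableSet_goodNoise X β σ)] at h
  norm_num at h ⊢
  linarith

theorem le_gaussianNoise_goodNoise_inter (hn : 0 < n) {β : EuclideanSpace ℝ (Fin p)}
    (hs : 1 ≤ sparsity β) {σ : ℝ} (hσ : 0 < σ) (v : EuclideanSpace ℝ (Fin n)) :
    0.26 ≤ (gaussianNoise n σ).real (goodNoise X β σ ∩ {e | 0 ≤ ⟪e, v⟫}) := by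
  have h := gaussianNoise_goodNoise_compl_le X hn hs hσ
  have h2 := half_le_gaussianNoise_inner_nonneg hσ v
  have hsub : {e | 0 ≤ ⟪e, v⟫} ⊆
      (goodNoise X β σ ∩ {e | 0 ≤ ⟪e, v⟫}) ∪ (goodNoise X β σ)ᶜ := by
    intro x hx
    by_cases hg : x ∈ goodNoise X β σ
    · exact Or.inl ⟨hg, hx⟩
    · exact Or.inr hg
  have h3 := (measureReal_mono hsub).trans (measureReal_union_le (μ := gaussianNoise n σ) _ _)
  norm_num at h ⊢
  linarith

/-- The condition on the tuning parameter. -/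
def TuningCondition (β : EuclideanSpace ℝ (Fin p)) (σ γ lam : ℝ) : Prop :=
  σ * (1 + γ) * (1 + ripConst X (sparsity β)) * (1 + √(2 * logTerm p (sparsity β))) ≤ lam

/-! ### Error bounds on the favourable event -/

variable {X} {β : EuclideanSpace ℝ (Fin p)} {σ γ lam : ℝ}

theorem TuningCondition.pos (h : TuningCondition X β σ γ lam) (hσ : 0 < σ) (hγ : 0 < γ) :
    0 < lam := by
  refine lt_of_lt_of_le ?_ h
  have := columnLevel_pos X β hσ
  rw [columnLevel] at this
  calc (0 : ℝ) < (1 + γ) * (σ * (1 + ripConst X (sparsity β))) *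
        (1 + √(2 * logTerm p (sparsity β))) := by positivity
    _ = _ := by ring

theorem inner_add_penalty_le (hσ : 0 < σ) (hγ : 0 < γ) (hs : 1 ≤ sparsity β)
    (hκ : 0 < reConst X (coneConst γ) (sparsity β)) (hlam : TuningCondition X β σ γ lam)
    {e : EuclideanSpace ℝ (Fin n)} (he : e ∈ goodNoise X β σ) (u : EuclideanSpace ℝ (Fin p)) :
    ⟪e, X.toEuclideanLin u⟫ + lassoPenalty n lam β - lassoPenalty n lam (β + u) ≤
      upperC X (sparsity β) σ γ lam * lam * √(sparsity β : ℝ) * ‖X.toEuclideanLin u‖ := by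
  have hlam0 := hlam.pos hσ hγ
  have hn := pos_of_reConst_pos X hκ
  have hn' : 0 < √(n : ℝ) := Real.sqrt_pos.2 (by exact_mod_cast hn)
  have hw0 := columnLevel_pos X β hσ
  have hL1 : 1 ≤ logTerm p (sparsity β) := logTerm_ge_one hs (sparsity_le β)
  have htail := tailSum_card_le u (support β)
  have hcone := le_toEuclideanLin_of_tailSum_le X (c := coneConst γ) (s := sparsity β) (α := u)
  have hpen := l1Norm_sub_l1Norm_add_le β u
  obtain ⟨hA, hB⟩ := he
  change tailSum (sparsity β) u ≤ _ at htail
  have hlam' : (1 + γ) * (columnLevel X β σ * (1 + √(2 * logTerm p (sparsity β)))) ≤ lam := by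
    refine le_trans (le_of_eq ?_) hlam
    rw [columnLevel]; ring
  unfold upperC
  set s := sparsity β
  set w := columnLevel X β σ
  set L := logTerm p s
  set κ := reConst X (coneConst γ) s
  set M := ‖X.toEuclideanLin u‖
  set q := ∑ j ∈ (support β)ᶜ, |u j|
  set S := √(s : ℝ) with hS
  set τ := w * √(2 * L) with hτ
  have hS0 : 0 < S := Real.sqrt_pos.2 (by exact_mod_cast hs)
  have hL0 : 0 < √L := Real.sqrt_pos.2 (by linarith)
  have hr2 : (√6 * w * S) ^ 2 = 6 * w ^ 2 * s := by
    rw [mul_pow, mul_pow, Real.sq_sqrt (by norm_num), hS, Real.sq_sqrt (by positivity)]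
  have hI := inner_toEuclideanLin_le X hn β u e (r := √6 * w * S) (by positivity)
    (hB.trans hr2.ge)
  have h3 : √6 = √3 * √2 := by rw [← Real.sqrt_mul (by norm_num)]; norm_num
  have hτ2 : τ = w * (√2 * √L) := by rw [hτ, Real.sqrt_mul (by norm_num)]
  have hL1' : 1 ≤ √L := Real.one_le_sqrt.2 hL1
  have hM0 : 0 ≤ M := norm_nonneg _
  have hu0 : 0 ≤ ‖u‖ := norm_nonneg _
  have h32 : 0 < √3 := by positivity
  have h22 : 0 < √2 := by positivity
  have hwτ : w * √2 ≤ τ := by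
    rw [hτ2]
    exact mul_le_mul_of_nonneg_left (le_mul_of_one_le_right h22.le hL1') hw0.le
  have hlamτ : (1 + γ) * τ ≤ lam := by
    refine le_trans ?_ hlam'
    refine mul_le_mul_of_nonneg_left ?_ (by positivity)
    rw [hτ]; nlinarith
  have hD : ⟪e, X.toEuclideanLin u⟫ + lassoPenalty n lam β - lassoPenalty n lam (β + u) ≤
      σ * (S + 2 * √(Real.log 3)) * M +
        √(n : ℝ) * ((lam * S + √6 * w * S) * ‖u‖ - (lam - τ) * q) := by
    have h1 : lassoPenalty n lam β - lassoPenalty n lam (β + u) ≤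
        √(n : ℝ) * lam * (S * ‖u‖ - q) := by
      unfold lassoPenalty
      rw [← mul_sub]
      exact mul_le_mul_of_nonneg_left hpen (by positivity)
    have h2 := mul_le_mul_of_nonneg_right hA hM0
    linarith
  have hsplit : 1 / κ * (1 + σ * κ * (S + 2 * √(Real.log 3)) / (lam * S) + √3 / √L) * lam * S * M
      = σ * (S + 2 * √(Real.log 3)) * M + (lam * S + √3 * lam * S / √L) / κ * M := by
    field_simp
    ring
  rw [hsplit]
  -- Since `√6 · w√L = √3 · τ` and `τ ≤ λ`, the excess radius yields the last term of `C̄`.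
  have hrle : √6 * w * S ≤ √3 * lam * S / √L := by
    rw [le_div_iff₀ hL0]
    have h1 : τ ≤ lam := by nlinarith [mul_nonneg hγ.le (hwτ.trans' (by positivity))]
    calc √6 * w * S * √L = √3 * S * τ := by rw [h3, hτ2]; ring
      _ ≤ √3 * S * lam := by gcongr
      _ = _ := by ring
  refine hD.trans ?_
  -- Cone dichotomy: if the off-support mass `q` dominates, the bracket in `hD` is negative;
  -- otherwise `u` satisfies the cone condition.
  rcases le_or_gt ((lam - τ) * q) ((lam * S + √6 * w * S) * ‖u‖) with hc | hc
  · have hlt : 0 < lam - τ := by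
      have : 0 < γ * τ := mul_pos hγ (by positivity)
      linarith
    have hq : q ≤ coneConst γ * S * ‖u‖ := by
      have h1 : lam * S + √6 * w * S ≤ (lam - τ) * (coneConst γ * S) := by
        have hγlam : γ * lam ≤ (1 + γ) * (lam - τ) := by linarith
        have h4 : √6 * w ≤ √3 * τ := by
          rw [h3, mul_assoc, mul_comm √2]; exact mul_le_mul_of_nonneg_left hwτ h32.le
        -- Origin of `c₀`: `(1 + γ)τ ≤ λ` gives `λ - τ ≥ γλ/(1 + γ)` and `λ + √6 w ≤ λ + √3 τ ≤ λ(1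
        -- + γ + √3)/(1 + γ)`.
        have h5 : lam + √6 * w ≤ (lam - τ) * coneConst γ := by
          rw [coneConst, ← mul_div_assoc, le_div_iff₀ hγ]
          have h6 := mul_le_mul_of_nonneg_left hlamτ h32.le
          have h7 := mul_le_mul_of_nonneg_left h4 hγ.le
          linarith
        calc lam * S + √6 * w * S = (lam + √6 * w) * S := by ring
          _ ≤ (lam - τ) * coneConst γ * S := by gcongr
          _ = _ := by ring
      refine le_of_mul_le_mul_left ?_ hlt
      calc (lam - τ) * q ≤ (lam * S + √6 * w * S) * ‖u‖ := hc
        _ ≤ (lam - τ) * (coneConst γ * S) * ‖u‖ := by gcongr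
        _ = _ := by ring
    have hM := hcone (htail.trans hq) hn
    have hq0 : 0 ≤ q := Finset.sum_nonneg fun j _ => abs_nonneg _
    have h8 : √(n : ℝ) * ‖u‖ ≤ M / κ := by rw [le_div_iff₀ hκ]; linarith
    have h9 : √(n : ℝ) * ((lam * S + √6 * w * S) * ‖u‖ - (lam - τ) * q) ≤
        (lam * S + √3 * lam * S / √L) / κ * M := by
      calc √(n : ℝ) * ((lam * S + √6 * w * S) * ‖u‖ - (lam - τ) * q)
          ≤ √(n : ℝ) * ((lam * S + √6 * w * S) * ‖u‖) := by
            refine mul_le_mul_of_nonneg_left ?_ hn'.le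
            linarith [mul_nonneg hlt.le hq0]
        _ = (lam * S + √6 * w * S) * (√(n : ℝ) * ‖u‖) := by ring
        _ ≤ (lam * S + √3 * lam * S / √L) * (M / κ) := by gcongr
        _ = _ := by ring
    linarith
  · have h9 : √(n : ℝ) * ((lam * S + √6 * w * S) * ‖u‖ - (lam - τ) * q) ≤ 0 :=
      mul_nonpos_of_nonneg_of_nonpos hn'.le (by linarith)
    have h10 : 0 ≤ (lam * S + √3 * lam * S / √L) / κ * M := by positivity
    linarith

theorem predError_le (hσ : 0 < σ) (hγ : 0 < γ) (hs : 1 ≤ sparsity β)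
    (hκ : 0 < reConst X (coneConst γ) (sparsity β)) (hlam : TuningCondition X β σ γ lam)
    {e : EuclideanSpace ℝ (Fin n)} (he : e ∈ goodNoise X β σ) {b : EuclideanSpace ℝ (Fin p)}
    (hb : IsLasso X lam (X.toEuclideanLin β + e) b) :
    predError X b β ≤ upperC X (sparsity β) σ γ lam * lam * √(sparsity β : ℝ) := by
  have hD := inner_add_penalty_le hσ hγ hs hκ hlam he (b - β)
  rw [add_sub_cancel] at hD
  have hk := hb.inner_le X (hlam.pos hσ hγ).le β
  have h1 : X.toEuclideanLin b - (X.toEuclideanLin β + e) = X.toEuclideanLin (b - β) - e := by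
    rw [map_sub]; abel
  rw [h1, inner_sub_left, real_inner_self_eq_norm_sq] at hk
  unfold predError
  -- The bound is obtained by dividing by the prediction error, so a zero error is treated apart.
  rcases (norm_nonneg (X.toEuclideanLin (b - β))).eq_or_lt with h0 | h0
  · rw [← h0]
    have := hlam.pos hσ hγ
    unfold upperC
    positivity
  · refine le_of_mul_le_mul_right ?_ h0
    linarith

/-- The vector of signs of the components of `β`. -/
noncomputable def signVec (β : EuclideanSpace ℝ (Fin p)) : EuclideanSpace ℝ (Fin p) :=
  WithLp.toLp 2 fun j => Real.sign (β j)

theorem sparsity_signVec_le (β : EuclideanSpace ℝ (Fin p)) :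
    sparsity (signVec β) ≤ sparsity β := by
  refine Finset.card_le_card fun j hj => ?_
  rw [Finset.mem_filter] at hj ⊢
  exact ⟨Finset.mem_univ _, fun h => hj.2 (by simp [signVec, h])⟩

theorem norm_signVec (β : EuclideanSpace ℝ (Fin p)) : ‖signVec β‖ = √(sparsity β : ℝ) := by
  rw [EuclideanSpace.norm_eq, sparsity, Finset.card_filter]
  congr 1
  push_cast
  refine Finset.sum_congr rfl fun j _ => ?_
  rcases lt_trichotomy (β j) 0 with h | h | h
  · simp [signVec, Real.sign_of_neg h, h.ne]
  · simp [signVec, h]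
  · simp [signVec, Real.sign_of_pos h, h.ne']

/-- No nonzero coordinate crosses zero, so each loses exactly `t` in absolute value. -/
theorem l1Norm_sub_smul_signVec {t : ℝ} (ht : ∀ j, β j ≠ 0 → t ≤ |β j|) :
    l1Norm (β - t • signVec β) = l1Norm β - t * sparsity β := by
  rw [sparsity, Finset.card_filter]
  unfold l1Norm
  push_cast
  rw [Finset.mul_sum, ← Finset.sum_sub_distrib]
  refine Finset.sum_congr rfl fun j _ => ?_
  rcases lt_trichotomy (β j) 0 with h | h | h
  · have := ht j h.ne
    rw [abs_of_neg h] at this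
    simp only [signVec, PiLp.sub_apply, PiLp.smul_apply, Real.sign_of_neg h, smul_eq_mul,
      if_pos h.ne, abs_of_neg h]
    rw [abs_of_nonpos (by linarith)]; ring
  · simp [signVec, h]
  · have := ht j h.ne'
    rw [abs_of_pos h] at this
    simp only [signVec, PiLp.sub_apply, PiLp.smul_apply, Real.sign_of_pos h, smul_eq_mul,
      if_pos h.ne', abs_of_pos h]
    rw [abs_of_nonneg (by linarith)]

theorem le_predError (hσ : 0 < σ) (hγ : 0 < γ) (hs : 1 ≤ sparsity β)
    (hκ : 0 < reConst X (coneConst γ) (sparsity β)) (hlam : TuningCondition X β σ γ lam)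
    (hC : upperC X (sparsity β) σ γ lam ≤ 2 * lowerC X (sparsity β))
    (hmin : BetaMin X β σ γ lam)
    {e : EuclideanSpace ℝ (Fin n)} (he : e ∈ goodNoise X β σ)
    (hsign : 0 ≤ ⟪e, -X.toEuclideanLin (signVec β)⟫) {b : EuclideanSpace ℝ (Fin p)}
    (hb : IsLasso X lam (X.toEuclideanLin β + e) b) :
    lam * √(sparsity β : ℝ) * lowerFactor X (sparsity β) σ γ lam ≤ predError X b β := by
  have hlam0 := hlam.pos hσ hγ
  have hn := pos_of_reConst_pos X hκ
  have hn' : 0 < √(n : ℝ) := Real.sqrt_pos.2 (by exact_mod_cast hn)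
  have hD := inner_add_penalty_le hσ hγ hs hκ hlam he (b - β)
  rw [add_sub_cancel] at hD
  have hδ := (ripConst_spec X (sparsity β)).1
  have hXg := norm_toEuclideanLin_le_of_sparsity_le X hn (sparsity_signVec_le β)
  rw [norm_signVec] at hXg
  unfold BetaMin at hmin
  unfold predError lowerFactor
  have hlow : lowerC X (sparsity β) = 1 / (1 + ripConst X (sparsity β)) := rfl
  have hs2 : √(sparsity β : ℝ) ^ 2 = sparsity β := Real.sq_sqrt (by positivity)
  have hS0 : 0 < √(sparsity β : ℝ) := Real.sqrt_pos.2 (by exact_mod_cast hs)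
  set S := √(sparsity β : ℝ)
  set Cl := lowerC X (sparsity β)
  set Cu := upperC X (sparsity β) σ γ lam
  set δ := ripConst X (sparsity β)
  have hCl : 0 < Cl := by rw [hlow]; positivity
  have hClδ : Cl * (1 + δ) = 1 := by rw [hlow]; field_simp
  -- Chosen so that the cross term costs `(2Cl - Cu)λSM`; added to the `CuλSM` from `hD` this makes
  -- `2ClλSM`, which completes a square.
  set t := (2 * Cl - Cu) * Cl * lam / √(n : ℝ) with ht
  have ht0 : 0 ≤ t := by
    have : 0 ≤ 2 * Cl - Cu := by linarith
    positivity
  have hnt : √(n : ℝ) * t = (2 * Cl - Cu) * Cl * lam := by rw [ht]; field_simp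
  set g := signVec β
  have hk := hb.inner_le X hlam0.le (β - t • g)
  have h1 : X.toEuclideanLin b - (X.toEuclideanLin β + e) = X.toEuclideanLin (b - β) - e := by
    rw [map_sub]; abel
  have h2 : X.toEuclideanLin (b - (β - t • g)) =
      X.toEuclideanLin (b - β) + t • X.toEuclideanLin g := by
    rw [← map_smul, ← map_add]; congr 1; abel
  have h3 : lassoPenalty n lam (β - t • g) =
      lassoPenalty n lam β - √(n : ℝ) * t * lam * sparsity β := by
    unfold lassoPenalty
    rw [l1Norm_sub_smul_signVec hmin]; ring
  rw [h1, h2, h3, inner_sub_left, inner_add_right, inner_add_right, inner_smul_right,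
    inner_smul_right, real_inner_self_eq_norm_sq, hnt, ← hs2] at hk
  rw [inner_neg_right] at hsign
  set M := ‖X.toEuclideanLin (b - β)‖
  have hM0 : 0 ≤ M := norm_nonneg _
  have h4 : -(M * (√(n : ℝ) * ((1 + δ) * S))) ≤
      ⟪X.toEuclideanLin (b - β), X.toEuclideanLin g⟫ := by
    have := (abs_le.1 (abs_real_inner_le_norm (X.toEuclideanLin (b - β))
      (X.toEuclideanLin g))).1
    have h5 := mul_le_mul_of_nonneg_left hXg hM0
    linarith
  have h6 := mul_le_mul_of_nonneg_left h4 ht0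
  have h7 : t * -(M * (√(n : ℝ) * ((1 + δ) * S))) = -((2 * Cl - Cu) * lam * S * M) := by
    calc t * -(M * (√(n : ℝ) * ((1 + δ) * S))) = -((√(n : ℝ) * t) * (1 + δ) * S * M) := by ring
      _ = -((2 * Cl - Cu) * lam * S * M * (Cl * (1 + δ))) := by rw [hnt]; ring
      _ = _ := by rw [hClδ, mul_one]
  have h8 := mul_nonneg ht0 hsign
  -- The condition reads `M² - 2ClλSM + Cl(2Cl - Cu)(λS)² ≤ 0`; in particular `Cl ≤ Cu` comes for
  -- free.
  have h9 : (Cl * (lam * S) - M) ^ 2 ≤ (Cl * (lam * S)) ^ 2 * (Cu / Cl - 1) := by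
    have e1 : (Cl * (lam * S)) ^ 2 * (Cu / Cl - 1) = Cl * (Cu - Cl) * (lam * S) ^ 2 := by
      field_simp
    rw [e1]
    rw [h7] at h6
    nlinarith
  have h10 := Real.abs_le_sqrt h9
  rw [Real.sqrt_mul (by positivity), Real.sqrt_sq (by positivity)] at h10
  have := (abs_le.1 h10).2
  linarith

end Event

/-! ### Asymptotics -/

section Asymptotics

variable {n p : ℕ → ℕ} {X : ∀ k, Matrix (Fin (n k)) (Fin (p k)) ℝ} {s : ℕ → ℕ}

theorem tendsto_logTerm (hps : Tendsto (fun k => (p k : ℝ) / (s k : ℝ)) atTop atTop) :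
    Tendsto (fun k => logTerm (p k) (s k)) atTop atTop := by
  have h := Real.tendsto_log_atTop.comp
    (hps.const_mul_atTop (show (0 : ℝ) < 9 * Real.exp 1 by positivity))
  refine h.congr fun k => ?_
  simp only [Function.comp_apply, logTerm, mul_div_assoc]

theorem tendsto_lam {σ γ : ℝ} (hσ : 0 < σ) (hγ : 0 < γ)
    (hps : Tendsto (fun k => (p k : ℝ) / (s k : ℝ)) atTop atTop) :
    Tendsto (fun k => σ * (1 + 2 * γ) * √(2 * Real.log ((p k : ℝ) / (s k : ℝ)))) atTop atTop :=
  (Real.tendsto_sqrt_atTop.comp ((Real.tendsto_log_atTop.comp hps).const_mul_atTop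
    zero_lt_two)).const_mul_atTop (by positivity)

/-- As `s ≥ 1`, the ratio `(√s + 2√(log 3))/√s` stays bounded, so the noise term is of order `1/λ`.
-/
theorem tendsto_upperC {σ γ : ℝ} {lam : ℕ → ℝ} (hs : ∀ k, 1 ≤ s k)
    (hps : Tendsto (fun k => (p k : ℝ) / (s k : ℝ)) atTop atTop)
    (hlam : Tendsto lam atTop atTop)
    (hκ : Tendsto (fun k => reConst (X k) (coneConst γ) (s k)) atTop (𝓝 1)) :
    Tendsto (fun k => upperC (X k) (s k) σ γ (lam k)) atTop (𝓝 1) := by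
  have h1 : Tendsto (fun k => √3 / √(logTerm (p k) (s k))) atTop (𝓝 0) :=
    tendsto_const_nhds.div_atTop (Real.tendsto_sqrt_atTop.comp (tendsto_logTerm hps))
  have h2 : Tendsto (fun k => σ * reConst (X k) (coneConst γ) (s k) / lam k) atTop (𝓝 0) :=
    (tendsto_const_nhds.mul hκ).div_atTop hlam
  have h3 : Tendsto (fun k => σ * reConst (X k) (coneConst γ) (s k) *
      (√(s k : ℝ) + 2 * √(Real.log 3)) / (lam k * √(s k : ℝ))) atTop (𝓝 0) := by
    have h4 := h2.norm.mul_const (1 + 2 * √(Real.log 3))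
    rw [norm_zero, zero_mul] at h4
    refine squeeze_zero_norm (fun k => ?_) h4
    rw [← div_mul_div_comm, norm_mul]
    refine mul_le_mul_of_nonneg_left ?_ (norm_nonneg _)
    have hS : 1 ≤ √(s k : ℝ) := Real.one_le_sqrt.2 (by exact_mod_cast hs k)
    rw [Real.norm_of_nonneg (by positivity), div_le_iff₀ (by linarith)]
    nlinarith [Real.sqrt_nonneg (Real.log 3)]
  have h5 := (tendsto_const_nhds (x := (1 : ℝ)).div hκ one_ne_zero).mul
    ((h3.const_add 1).add h1)
  simpa [upperC] using h5

theorem tendsto_lowerC (hδ : Tendsto (fun k => ripConst (X k) (s k)) atTop (𝓝 0)) :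
    Tendsto (fun k => lowerC (X k) (s k)) atTop (𝓝 1) := by
  have h := (hδ.const_add 1).inv₀ (by norm_num)
  simpa [lowerC] using h

theorem tendsto_lowerFactor {σ γ : ℝ} {lam : ℕ → ℝ}
    (hU : Tendsto (fun k => upperC (X k) (s k) σ γ (lam k)) atTop (𝓝 1))
    (hL : Tendsto (fun k => lowerC (X k) (s k)) atTop (𝓝 1)) :
    Tendsto (fun k => lowerFactor (X k) (s k) σ γ (lam k)) atTop (𝓝 1) := by
  have h := hL.mul ((((hU.div hL one_ne_zero).sub_const 1).sqrt).const_sub 1)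
  simpa [lowerFactor] using h

/-- The factor `1 + 2γ` leaves room: `(1 + γ)(1 + δ_s)` is eventually below `1 + 3γ/2`, and the
remaining `γ/2` times the diverging root absorbs the constants `1` and `√(2 log(9e))`. -/
theorem eventually_tuning {σ γ : ℝ} (hσ : 0 < σ) (hγ : 0 < γ)
    (hps : Tendsto (fun k => (p k : ℝ) / (s k : ℝ)) atTop atTop)
    (hδ : Tendsto (fun k => ripConst (X k) (s k)) atTop (𝓝 0)) :
    ∀ᶠ k in atTop, σ * (1 + γ) * (1 + ripConst (X k) (s k)) *
      (1 + √(2 * logTerm (p k) (s k))) ≤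
        σ * (1 + 2 * γ) * √(2 * Real.log ((p k : ℝ) / (s k : ℝ))) := by
  set c := Real.log (9 * Real.exp 1)
  have hz : Tendsto (fun k => √(2 * Real.log ((p k : ℝ) / (s k : ℝ)))) atTop atTop :=
    Real.tendsto_sqrt_atTop.comp ((Real.tendsto_log_atTop.comp hps).const_mul_atTop zero_lt_two)
  have h1 : ∀ᶠ k in atTop, (1 + γ) * (1 + ripConst (X k) (s k)) < 1 + 3 / 2 * γ := by
    have h := (hδ.const_add 1).const_mul (1 + γ)
    refine h.eventually_lt_const ?_
    linarith
  filter_upwards [h1, hps.eventually_ge_atTop 1,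
    hz.eventually_ge_atTop ((1 + 3 / 2 * γ) * (1 + √(2 * c)) / (γ / 2))] with k hk hx hzk
  have hc : 0 ≤ c := Real.log_nonneg (by linarith [Real.one_le_exp zero_le_one])
  have hℓ := Real.log_nonneg hx
  set x := (p k : ℝ) / (s k : ℝ)
  have hlog : logTerm (p k) (s k) = c + Real.log x := by
    rw [logTerm, mul_div_assoc, Real.log_mul (by positivity) (by positivity)]
  have hsqrt : √(2 * logTerm (p k) (s k)) ≤ √(2 * c) + √(2 * Real.log x) := by
    rw [hlog, mul_add]
    rw [Real.sqrt_le_left (by positivity), add_sq, Real.sq_sqrt (by positivity),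
      Real.sq_sqrt (by positivity)]
    have : 0 ≤ 2 * √(2 * c) * √(2 * Real.log x) := by positivity
    linarith
  rw [div_le_iff₀ (by positivity)] at hzk
  have hδ0 := (ripConst_spec (X k) (s k)).1
  calc σ * (1 + γ) * (1 + ripConst (X k) (s k)) * (1 + √(2 * logTerm (p k) (s k)))
      = σ * (((1 + γ) * (1 + ripConst (X k) (s k))) * (1 + √(2 * logTerm (p k) (s k)))) := by ring
    _ ≤ σ * ((1 + 3 / 2 * γ) * (1 + (√(2 * c) + √(2 * Real.log x)))) := by gcongr
    _ ≤ σ * ((1 + 2 * γ) * √(2 * Real.log x)) :=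
        mul_le_mul_of_nonneg_left (by linarith) hσ.le
    _ = _ := by ring

end Asymptotics

/-- Only `G` must be measurable: the estimator is an arbitrary selection of minimizers, so events
about it need not be, and monotonicity holds for all sets. -/
theorem le_measureReal_of_hasLaw {Ω E : Type*} [MeasurableSpace Ω] [MeasurableSpace E]
    {P : Measure Ω} [IsProbabilityMeasure P] {μ : Measure E} {ε : Ω → E} (hε : HasLaw ε μ P)
    {G : Set E} (hG : MeasurableSet G) {c : ℝ} (hc : c ≤ μ.real G) {A : Set Ω}
    (hA : ∀ ω, ε ω ∈ G → ω ∈ A) : c ≤ P.real A := by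
  rw [← hε.map_eq, map_measureReal_apply_of_aemeasurable hε.aemeasurable hG] at hc
  exact hc.trans (measureReal_mono hA)

end ExactLasso
theorem mainTheorem1 (σ γ : ℝ) (hσ : 0 < σ) (hγ : 0 < γ) :
    -- the nonasymptotic bounds, for one regression problem
    (∀ (n p : ℕ) (X : Matrix (Fin n) (Fin p) ℝ) (βstar : EuclideanSpace ℝ (Fin p)) (lam : ℝ)
        (Ω : Type*) [MeasurableSpace Ω] (P : Measure Ω) [IsProbabilityMeasure P]
        (ε : Ω → EuclideanSpace ℝ (Fin n)) (βhat : Ω → EuclideanSpace ℝ (Fin p)),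
      HasLaw ε (gaussianNoise n σ) P →
      (∀ ω, IsLasso X lam (X.toEuclideanLin βstar + ε ω) (βhat ω)) →
      1 ≤ sparsity βstar →
      0 < reConst X (coneConst γ) (sparsity βstar) →
      σ * (1 + γ) * (1 + ripConst X (sparsity βstar)) *
          (1 + √(2 * logTerm p (sparsity βstar))) ≤ lam →
      0.76 ≤ P.real {ω | predError X (βhat ω) βstar ≤
          upperC X (sparsity βstar) σ γ lam * lam * √(sparsity βstar : ℝ)} ∧
      (upperC X (sparsity βstar) σ γ lam ≤ 2 * lowerC X (sparsity βstar) →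
        BetaMin X βstar σ γ lam →
        0.26 ≤ P.real {ω | lam * √(sparsity βstar : ℝ) *
            lowerFactor X (sparsity βstar) σ γ lam ≤ predError X (βhat ω) βstar})) ∧
    -- asymptotic tightness, along a sequence of regression problems
    (∀ (n p : ℕ → ℕ) (X : ∀ k, Matrix (Fin (n k)) (Fin (p k)) ℝ)
        (βstar : ∀ k, EuclideanSpace ℝ (Fin (p k))) (lam : ℕ → ℝ)
        (Ω : ℕ → Type*) [∀ k, MeasurableSpace (Ω k)] (P : ∀ k, Measure (Ω k))
        [∀ k, IsProbabilityMeasure (P k)]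
        (ε : ∀ k, Ω k → EuclideanSpace ℝ (Fin (n k)))
        (βhat : ∀ k, Ω k → EuclideanSpace ℝ (Fin (p k))),
      (∀ k, HasLaw (ε k) (gaussianNoise (n k) σ) (P k)) →
      (∀ k ω, IsLasso (X k) (lam k) ((X k).toEuclideanLin (βstar k) + ε k ω) (βhat k ω)) →
      (∀ k, 1 ≤ sparsity (βstar k)) →
      Tendsto (fun k => (p k : ℝ) / (sparsity (βstar k) : ℝ)) atTop atTop →
      (∀ k, lam k = σ * (1 + 2 * γ) *
        √(2 * Real.log ((p k : ℝ) / (sparsity (βstar k) : ℝ)))) →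
      Tendsto (fun k => ripConst (X k) (sparsity (βstar k))) atTop (𝓝 0) →
      Tendsto (fun k => reConst (X k) (coneConst γ) (sparsity (βstar k))) atTop (𝓝 1) →
      Tendsto (fun k => upperC (X k) (sparsity (βstar k)) σ γ (lam k)) atTop (𝓝 1) ∧
      Tendsto (fun k => lowerC (X k) (sparsity (βstar k))) atTop (𝓝 1) ∧
      Tendsto (fun k => lowerFactor (X k) (sparsity (βstar k)) σ γ (lam k)) atTop (𝓝 1) ∧
      ∀ᶠ k in atTop, BetaMin (X k) (βstar k) σ γ (lam k) →
        0.25 ≤ (P k).real {ω |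
          lowerFactor (X k) (sparsity (βstar k)) σ γ (lam k) ≤
            predError (X k) (βhat k ω) (βstar k) / (lam k * √(sparsity (βstar k) : ℝ)) ∧
          predError (X k) (βhat k ω) (βstar k) / (lam k * √(sparsity (βstar k) : ℝ)) ≤
            upperC (X k) (sparsity (βstar k)) σ γ (lam k)}) := by
  constructor
  · intro n p X βstar lam Ω _ P _ ε βhat hε hβ hs hκ hlam
    have hn := pos_of_reConst_pos X hκ
    refine ⟨?_, fun hC hmin => ?_⟩
    · exact le_measureReal_of_hasLaw hε (measurableSet_goodNoise X βstar σ)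
        (le_gaussianNoise_goodNoise X hn hs hσ)
        fun ω hω => predError_le hσ hγ hs hκ hlam hω (hβ ω)
    · exact le_measureReal_of_hasLaw hε
        ((measurableSet_goodNoise X βstar σ).inter (measurableSet_le (by fun_prop) (by fun_prop)))
        (le_gaussianNoise_goodNoise_inter X hn hs hσ (-X.toEuclideanLin (signVec βstar)))
        fun ω hω => le_predError hσ hγ hs hκ hlam hC hmin hω.1 hω.2 (hβ ω)
  · intro n p X βstar lam Ω _ P _ ε βhat hε hβ hs hps hlam hδ hκ
    have hlam_top : Tendsto lam atTop atTop := by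
      simpa only [← hlam] using tendsto_lam hσ hγ hps
    have hU := tendsto_upperC (σ := σ) hs hps hlam_top hκ
    have hL := tendsto_lowerC hδ
    refine ⟨hU, hL, tendsto_lowerFactor hU hL, ?_⟩
    have hC : ∀ᶠ k in atTop, upperC (X k) (sparsity (βstar k)) σ γ (lam k) ≤
        2 * lowerC (X k) (sparsity (βstar k)) :=
      (hU.eventually_lt (hL.const_mul 2) (by norm_num)).mono fun k hk => hk.le
    filter_upwards [hC, eventually_tuning hσ hγ hps hδ,
      hκ.eventually_const_lt zero_lt_one] with k hCk htune hκk hmin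
    rw [← hlam k] at htune
    have hlam0 : 0 < lam k := TuningCondition.pos htune hσ hγ
    have hpos : 0 < lam k * √(sparsity (βstar k) : ℝ) :=
      mul_pos hlam0 (Real.sqrt_pos.2 (by exact_mod_cast hs k))
    have hn := pos_of_reConst_pos (X k) hκk
    -- Both inequalities hold on the event used for the lower bound, so no further union bound is
    -- needed and its `0.26` exceeds `0.25`.
    refine le_trans (by norm_num) (le_measureReal_of_hasLaw (hε k)
      ((measurableSet_goodNoise (X k) (βstar k) σ).inter
        (measurableSet_le (by fun_prop) (by fun_prop)))
      (le_gaussianNoise_goodNoise_inter (X k) hn (hs k) hσ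
        (-(X k).toEuclideanLin (signVec (βstar k))))
      fun ω hω => ⟨?_, ?_⟩)
    · rw [le_div_iff₀ hpos, mul_comm]
      exact le_predError hσ hγ (hs k) hκk htune hCk hmin hω.1 hω.2 (hβ k ω)
    · rw [div_le_iff₀ hpos, ← mul_assoc]
      exact predError_le hσ hγ (hs k) hκk htune hω.1 (hβ k ω)
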